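/- For $n\ge 1$ and a nonempty binary code $\mathcal C\subseteq\{0,1\}^n$, the rate of $\mathcal C$ is $\frac1n\log_2|\mathcal C|$; its minimum distance is at least $\Delta$ if any two distinct codewords have Hamming distance at least $\Delta$; and its VC-dimension is the largest size of a coordinate set $I\subseteq\{1,\dots,n\}$ such that the projection of $\mathcal C$ onto $I$ is all of $\{0,1\}^{I}$. A real number $R$ is $(d,\delta)$-achievable if for infinitely many $n$ there is a nonempty code of length $n$ with rate at least $R$, VC-dimension at most $dn$ and minimum distance at least $\delta n$. Let $C(d,\delta)$ be the supremum of all $(d,\delta)$-achievable $R$. A stationary Markov chain on a finite directed graph with vertex set $V$ and edge set $E$ is a function $P:E\to[0,1]$ with $\sum_{e\in E}P(e)=1$ such that for every vertex $u$ the total value of $P$ on the edges going out of $u$ equals that on the edges coming into $u$. For $f:E\to\mathbb R^k$ write $\mathbf E_P(f)=\sum_{e\in E}P(e)f(e)$, and let $H_P(Y|X)$ be the conditional entropy, with logarithms to the base $2$, of the target $Y$ given the source $X$ of an edge drawn with probabilities $P$. Let $G$ be the directed graph with vertices $a,b$ and the four edges $(a,a),(a,b),(b,a),(b,b)$, labeled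 by $L(a,b)=L(b,b)=0$ and $L(a,a)=L(b,a)=1$, and let $f(a,a)=f(b,b)=0$, $f(a,b)=f(b,a)=1$. Let $G\times G$ be the graph whose vertices are the pairs of vertices of $G$ and whose edges are the pairs $\langle e,e'\rangle$ of edges of $G$, where $\langle e,e'\rangle$ goes from the pair of sources to the pair of targets, and put $f^{(1)}(\langle e,e'\rangle)=f(e)$, $f^{(2)}(\langle e,e'\rangle)=f(e')$, and $\Delta(\langle e,e'\rangle)=1$ if $L(e)\ne L(e')$ and $0$ otherwise. For $p\in[0,1]$ and $\delta>0$ let $$F(p)=\sup\{H_P(Y|X): P \text{ a stationary Markov chain on } G,\ \mathbf E_P(f)=p\},$$ $$G(p,\delta)=\sup\{H_Q(Y|X): Q \text{ a stationary Markov chain on } G\times G,\ \mathbf E_Q(f^{(1)})=\mathbf E_Q(f^{(2)})=p,\ \mathbf E_Q(\Delta)\in[0,\delta)\},$$ and for $d\in[0,\tfrac12]$ $$R_{MA}(d,\delta)=\sup_{p\in[0,d]}\{2F(p)-G(p,\delta)\}.$$ Theorem. For all $d\in[0,\frac12]$ and $\delta\in(0,\frac12]$, $\;C(d,\delta)\ge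 R_{MA}(d,\delta)$. -/

import Mathlib

/-!
Binary codes with bounded VC-dimension and large minimum distance, and stationary Markov chains on
labeled directed graphs.  All logarithms are to the base 2.
-/

namespace VCCode

/-! ### Codes -/

/-- The projection of a binary code of length `n` onto the coordinate set `I`. -/
def projection {n : ℕ} (C : Finset (Fin n → Fin 2)) (I : Finset (Fin n)) :
    Finset (I → Fin 2) :=
  C.image fun x i => x i

/-- `C` shatters `I` if the projection of `C` onto `I` is all of `{0,1}^I`. -/
def Shatters {n : ℕ} (C : Finset (Fin n → Fin 2)) (I : Finset (Fin n)) : Prop :=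
  projection C I = Finset.univ

instance {n : ℕ} (C : Finset (Fin n → Fin 2)) : DecidablePred (Shatters C) :=
  fun I => inferInstanceAs (Decidable (projection C I = Finset.univ))

/-- The VC-dimension: the maximum size of a coordinate set shattered by `C`. -/
def vcDim {n : ℕ} (C : Finset (Fin n → Fin 2)) : ℕ :=
  (Finset.univ.filter (Shatters C)).sup Finset.card

/-- The minimum distance of `C` is at least `r`: two distinct codewords have Hamming distance at
least `r` (no condition on a code with a single codeword). -/
def MinDistAtLeast {n : ℕ} (C : Finset (Fin n → Fin 2)) (r : ℝ) : Prop :=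
  ∀ x ∈ C, ∀ y ∈ C, x ≠ y → r ≤ (hammingDist x y : ℝ)

/-- The rate of a code of length `n`. -/
noncomputable def rate {n : ℕ} (C : Finset (Fin n → Fin 2)) : ℝ :=
  Real.logb 2 (C.card : ℝ) / n

/-- `R` is `(d, δ)`-achievable: for infinitely many lengths `n` there is a (nonempty) code of
length `n` with rate at least `R`, VC-dimension at most `d n` and minimum distance at least
`δ n`. -/
def Achievable (d δ R : ℝ) : Prop :=
  {n : ℕ | ∃ C : Finset (Fin n → Fin 2), C.Nonempty ∧ R ≤ rate C ∧
    (vcDim C : ℝ) ≤ d * n ∧ MinDistAtLeast C (δ * n)}.Infinite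

/-- `C(d, δ)`, the supremum of all `(d, δ)`-achievable rates. -/
noncomputable def capacity (d δ : ℝ) : ℝ :=
  sSup {R : ℝ | Achievable d δ R}

/-! ### Labeled graphs and stationary Markov chains -/

/-- A directed graph with vertices `V`, edges `E`, and an edge labeling with values in `A`. -/
structure LabeledGraph (V E A : Type) where
  /-- the vertex from which an edge goes out -/
  src : E → V
  /-- the vertex into which an edge comes -/
  tgt : E → V
  /-- the labeling of the edges -/
  label : E → A

/-- The product of two labeled graphs: vertices are pairs of vertices, edges are pairs of edges. -/
def LabeledGraph.prod {V E A V' E' A' : Type} (G : LabeledGraph V E A)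
    (G' : LabeledGraph V' E' A') : LabeledGraph (V × V') (E × E') (A × A') where
  src e := (G.src e.1, G'.src e.2)
  tgt e := (G.tgt e.1, G'.tgt e.2)
  label e := (G.label e.1, G'.label e.2)

section Markov

variable {V E A : Type} [Fintype V] [DecidableEq V] [Fintype E]

/-- `P : E → [0,1]` is a stationary Markov chain on `G`: it has total mass one, and at every
vertex the mass of the outgoing edges equals the mass of the incoming edges. -/
structure IsStationaryMarkovChain (G : LabeledGraph V E A) (P : E → ℝ) : Prop where
  mem_Icc : ∀ e, P e ∈ Set.Icc (0 : ℝ) 1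
  sum_eq_one : ∑ e, P e = 1
  balance : ∀ u : V, ∑ e with G.src e = u, P e = ∑ e with G.tgt e = u, P e

/-- The expected value `E_P(f)` of a vector-valued function `f` on the edges. -/
def expect {W : Type} [AddCommGroup W] [Module ℝ W] (P : E → ℝ) (f : E → W) : W :=
  ∑ e, P e • f e

/-- `M(G; f, U)`: the stationary Markov chains `P` on `G` with `E_P(f) ∈ U`. -/
def chains (G : LabeledGraph V E A) {W : Type} [AddCommGroup W] [Module ℝ W]
    (f : E → W) (U : Set W) : Set (E → ℝ) :=
  {P | IsStationaryMarkovChain G P ∧ expect P f ∈ U}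

/-- The joint distribution of the random variables `X` (source) and `Y` (target) of a random edge:
`Pr{X = u, Y = v}`. -/
def jointProb (G : LabeledGraph V E A) (P : E → ℝ) (u v : V) : ℝ :=
  ∑ e with G.src e = u ∧ G.tgt e = v, P e

/-- The distribution of `X`: `Pr{X = u}`. -/
def srcProb (G : LabeledGraph V E A) (P : E → ℝ) (u : V) : ℝ :=
  ∑ v, jointProb G P u v

/-- The conditional entropy
`H_P(Y|X) = - ∑ Pr{X = u, Y = v} log₂ (Pr{X = u, Y = v} / Pr{X = u})`, where `0 log 0 = 0`. -/
noncomputable def condEntropy (G : LabeledGraph V E A) (P : E → ℝ) : ℝ :=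
  -∑ u, ∑ v, jointProb G P u v * Real.logb 2 (jointProb G P u v / srcProb G P u)

end Markov

/-! ### The two-state graph -/

/-- The two vertices of the graph. -/
inductive State where
  | a
  | b
  deriving DecidableEq

instance : Fintype State where
  elems := {State.a, State.b}
  complete := fun u => by cases u <;> decide

/-- The graph with vertices `a`, `b`, one edge for each ordered pair of vertices (loops included),
and the labeling `L(a,b) = L(b,b) = 0`, `L(b,a) = L(a,a) = 1`. -/
def twoState : LabeledGraph State (State × State) (Fin 2) where
  src e := e.1
  tgt e := e.2
  label e := if e.2 = State.a then 1 else 0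

/-- The switch indicator `f`: `f(a,a) = f(b,b) = 0`, `f(a,b) = f(b,a) = 1`. -/
def switch (e : State × State) : ℝ := if e.1 = e.2 then 0 else 1

/-- The function `Δ` on the edges of the squared graph, indicating that the labels disagree. -/
def disagree (e : (State × State) × (State × State)) : ℝ :=
  if twoState.label e.1 ≠ twoState.label e.2 then 1 else 0

/-- The function `φ = [f⁽¹⁾, f⁽²⁾, Δ]` on the edges of the squared graph. -/
def switchDisagree (e : (State × State) × (State × State)) : ℝ × ℝ × ℝ :=
  (switch e.1, switch e.2, disagree e)

/-- `F(U)`: the supremum of `H_P(Y|X)` over the stationary Markov chains `P` on the two-state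
graph with `E_P(f) ∈ U`. -/
noncomputable def entropyF (U : Set ℝ) : ℝ :=
  sSup (condEntropy twoState '' chains twoState switch U)

/-- `G(U, δ)`: the supremum of `H_Q(Y|X)` over the stationary Markov chains `Q` on the square of
the two-state graph with `E_Q(φ) ∈ U × U × [0, δ)`. -/
noncomputable def entropyG (U : Set ℝ) (δ : ℝ) : ℝ :=
  sSup (condEntropy (twoState.prod twoState) ''
    chains (twoState.prod twoState) switchDisagree (U ×ˢ U ×ˢ Set.Ico 0 δ))

/-- `R_MA(d, δ) = sup_{p ∈ [0, d]} (2 F({p}) - G({p}, δ))`. -/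
noncomputable def rateMA (d δ : ℝ) : ℝ :=
  sSup ((fun p : ℝ => 2 * entropyF {p} - entropyG {p} δ) '' Set.Icc 0 d)

end VCCode

/-! Fix p ≤ d and let S be the set of all words of length n with exactly k = ⌊pn⌋ switches, a switch
being a change of letter when the word is read after an initial 0. On a shattered set I some word
shows the pattern 1, 0, 1, 0, …, which costs |I| switches; hence every subcode of S has VC-dimension
at most k (`vcDim_le`). Words correspond to their switch sets, so |S| is n choose k, about 2^(n
h(p)) with h the binary entropy, and F(p) ≤ h(p) (`entropyF_le`).

The distance comes from an averaged Gilbert argument (`exists_separated_subset`): if T ordered pairs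
in S are closer than δn, some code in S with at least |S|²/(4T) words has no such pair. Its rate is
about 2h(p) - (1/n) log₂ T.

To bound T, read a pair of words as a walk on the squared graph. By the method of types
(`card_le_of_pairEntropy_le`), walks whose edge frequencies have conditional entropy at most c
number at most 2^(nc) up to a polynomial factor. The frequencies of a close pair are stationary up
to 1/n, have switch rates near p and disagreement below δ; by compactness
(`exists_condEntropy_le_entropyG_add`) their entropy is at most G(p,δ) + ε for large n. -/

-- By Markov's inequality at least half of `S` has degree at most twice the average `T / |S|`. A
-- maximal separated set among these elements has neighbourhoods covering them all, so `|S| / 2 ≤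
-- |C| * 2T / |S|`.
open Finset in
theorem exists_separated_subset {α : Type*} [DecidableEq α] (S : Finset α) (r : α → α → Prop)
    [DecidableRel r] (hr : ∀ x, r x x) (hsymm : ∀ x y, r x y → r y x) :
    ∃ C ⊆ S, (∀ x ∈ C, ∀ y ∈ C, x ≠ y → ¬ r x y) ∧
      S.card ^ 2 ≤ 4 * ((S ×ˢ S).filter fun z => r z.1 z.2).card * C.card := by
  set T := ((S ×ˢ S).filter fun z => r z.1 z.2).card with hT
  let deg : α → ℕ := fun x => (S.filter (r x)).card
  have hTsum : T = ∑ x ∈ S, deg x := by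
    simp only [hT, deg, card_filter, sum_product]
  let S' := S.filter fun x => deg x * S.card ≤ 2 * T
  have hS' : S.card ≤ 2 * S'.card := by
    by_contra! hlt
    have hsplit := card_filter_add_card_filter_not (s := S) (fun x => deg x * S.card ≤ 2 * T)
    have hbig : (S.filter fun x => ¬ deg x * S.card ≤ 2 * T).card * (2 * T)
        ≤ T * S.card := by
      rw [hTsum, sum_mul, ← hTsum, ← smul_eq_mul, ← sum_const]
      calc _ ≤ ∑ x ∈ S.filter (fun x => ¬ deg x * S.card ≤ 2 * T), deg x * S.card :=
            sum_le_sum fun x hx => (not_le.1 (mem_filter.1 hx).2).le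
        _ ≤ _ := sum_le_sum_of_subset (filter_subset _ _)
    -- Reflexivity enters here: the diagonal pairs make `T` positive, so it can be cancelled from
    -- the strict inequality.
    have hTpos : 0 < T := by
      have hS : 0 < S.card := by omega
      obtain ⟨x, hx⟩ := card_pos.1 hS
      exact card_pos.2 ⟨(x, x), by simp [hx, hr]⟩
    have : S.card < 2 * (S.filter fun x => ¬ deg x * S.card ≤ 2 * T).card := by
      have : 2 * S'.card < S.card := hlt
      change S'.card + _ = _ at hsplit
      omega
    nlinarith
  obtain ⟨C, hC⟩ := ((S'.powerset.filter fun C => ∀ x ∈ C, ∀ y ∈ C, x ≠ y → ¬ r x y)).exists_maximal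
    ⟨∅, by simp⟩
  have hCm := mem_filter.1 hC.prop
  have hCS : C ⊆ S' := mem_powerset.1 hCm.1
  refine ⟨C, hCS.trans (filter_subset _ _), hCm.2, ?_⟩
  -- An uncovered element could be added to `C`, against maximality.
  have hcover : S' ⊆ C.biUnion fun c => S.filter (r c) := by
    intro x hx
    by_contra hnot
    simp only [mem_biUnion, mem_filter, not_exists, not_and] at hnot
    have hxS := (mem_filter.1 hx).1
    have hxC : x ∉ C := fun h => hnot x h hxS (hr x)
    have hins : insert x C ∈ S'.powerset.filter fun C => ∀ x ∈ C, ∀ y ∈ C, x ≠ y → ¬ r x y := by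
      refine mem_filter.2 ⟨mem_powerset.2 (insert_subset hx hCS), ?_⟩
      intro y hy z hz hne
      rcases mem_insert.1 hy with hyx | hyC <;> rcases mem_insert.1 hz with hzx | hzC
      · exact absurd (hyx.trans hzx.symm) hne
      · exact hyx ▸ fun h => hnot z hzC hxS (hsymm _ _ h)
      · exact hzx ▸ hnot y hyC hxS
      · exact hCm.2 y hyC z hzC hne
    exact hxC (hC.le_of_ge hins (subset_insert _ _) (mem_insert_self _ _))
  have h1 : S'.card ≤ ∑ c ∈ C, deg c := (card_le_card hcover).trans card_biUnion_le
  have h2 : (∑ c ∈ C, deg c) * S.card ≤ C.card * (2 * T) := by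
    rw [sum_mul, ← smul_eq_mul, ← sum_const]
    exact sum_le_sum fun c hc => (mem_filter.1 (hCS hc)).2
  nlinarith [Nat.mul_le_mul_right S.card h1, Nat.mul_le_mul_right S.card hS']

/-! ### Entropy bound for binomial coefficients -/

theorem log_factorial_le (k : ℕ) :
    Real.log k.factorial ≤ k * Real.log k - k + Real.log (k + 1) + 1 := by
  -- This is k! ≤ k^(k+1) e^(1-k) with k = m + 1; the induction step amounts to (m+2)
  -- log((m+2)/(m+1)) ≥ 1.
  have key : ∀ m : ℕ, Real.log (m + 1).factorial
      ≤ (m + 2) * Real.log (m + 1) - (m + 1) + 1 := by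
    intro m
    induction m with
    | zero => simp
    | succ m ih =>
      rw [Nat.factorial_succ, Nat.cast_mul, Real.log_mul (by positivity) (by positivity)]
      have h : 1 / ((m : ℝ) + 2) ≤ Real.log (m + 2) - Real.log (m + 1) := by
        have := Real.log_le_sub_one_of_pos (x := ((m : ℝ) + 1) / (m + 2)) (by positivity)
        rw [Real.log_div (by positivity) (by positivity)] at this
        have e : ((m : ℝ) + 1) / (m + 2) - 1 = - (1 / (m + 2)) := by field_simp; ring
        linarith
      have h' : 1 ≤ ((m : ℝ) + 2) * (Real.log (m + 2) - Real.log (m + 1)) := by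
        have := mul_le_mul_of_nonneg_left h (by positivity : (0 : ℝ) ≤ m + 2)
        rwa [mul_one_div_cancel (by positivity)] at this
      push_cast
      rw [show (m : ℝ) + 1 + 1 = m + 2 by ring]
      linarith
  rcases k with _ | m
  · simp
  · have h := key m
    have h2 : Real.log ((m : ℝ) + 1) ≤ Real.log (m + 1 + 1) :=
      Real.log_le_log (by positivity) (by linarith)
    push_cast at h ⊢
    linarith

theorem le_log_factorial (n : ℕ) : n * Real.log n - n ≤ Real.log n.factorial := by
  rcases Nat.eq_zero_or_pos n with rfl | hn
  · simp
  · have h := Stirling.le_log_factorial_stirling hn.ne'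
    have h1 : 0 ≤ Real.log n := Real.log_nonneg (by exact_mod_cast hn)
    have h2 : 0 ≤ Real.log (2 * Real.pi) := Real.log_nonneg (by linarith [Real.pi_gt_three])
    linarith

theorem mul_binEntropy_sub_le_log_choose {n k : ℕ} (hn : 0 < n) (hk : k ≤ n) :
    n * Real.binEntropy (k / n) - 2 * Real.log (n + 1) - 2 ≤ Real.log (n.choose k) := by
  rw [Nat.choose_eq_factorial_div_factorial hk, Nat.cast_div (Nat.factorial_mul_factorial_dvd_factorial hk)
    (by positivity), Nat.cast_mul, Real.log_div (by positivity) (by positivity),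
    Real.log_mul (by positivity) (by positivity)]
  have h1 := log_factorial_le k
  have h2 := log_factorial_le (n - k)
  have h3 := le_log_factorial n
  have h4 : Real.log ((k : ℝ) + 1) ≤ Real.log (n + 1) :=
    Real.log_le_log (by positivity) (by gcongr)
  have h5 : Real.log (((n - k : ℕ) : ℝ) + 1) ≤ Real.log (n + 1) :=
    Real.log_le_log (by positivity) (by gcongr; omega)
  have hn' : (0 : ℝ) < n := by exact_mod_cast hn
  have h6 : n * Real.binEntropy (k / n) = n * Real.log n - k * Real.log k
      - (n - k : ℕ) * Real.log (n - k : ℕ) := by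
    have e : (1 : ℝ) - k / n = (n - k : ℕ) / n := by
      rw [Nat.cast_sub hk]; field_simp
    have aux : ∀ m : ℕ, (n : ℝ) * (m / n * Real.log ((m : ℝ) / n)) = m * Real.log m - m * Real.log n := by
      intro m
      rcases Nat.eq_zero_or_pos m with rfl | hm
      · simp
      · rw [Real.log_div (by positivity) (by positivity)]; field_simp
    rw [Real.binEntropy, e, Real.log_inv, Real.log_inv]
    have a1 := aux k
    have a2 := aux (n - k)
    have : ((n - k : ℕ) : ℝ) = n - k := Nat.cast_sub hk
    have a3 : ((n - k : ℕ) : ℝ) * Real.log n = (n - k) * Real.log n := by rw [this]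
    linarith
  have h7 : ((n - k : ℕ) : ℝ) = n - k := Nat.cast_sub hk
  linarith

/-! ### Switches and VC-dimension -/

namespace VCCode

/-- The number of elements of `s` below `t`. -/
def countLT {n : ℕ} (s : Finset (Fin n)) (t : ℕ) : ℕ := (s.filter fun j => j.val < t).card

theorem countLT_zero {n : ℕ} (s : Finset (Fin n)) : countLT s 0 = 0 := by simp [countLT]

theorem countLT_length {n : ℕ} (s : Finset (Fin n)) : countLT s n = s.card := by simp [countLT]

theorem countLT_succ {n : ℕ} (s : Finset (Fin n)) (i : Fin n) :
    countLT s (i + 1) = countLT s i + if i ∈ s then 1 else 0 := by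
  unfold countLT
  split_ifs with h
  · rw [← Finset.card_insert_of_notMem (a := i) (by simp)]
    congr 1
    ext j
    simp only [Finset.mem_filter, Finset.mem_insert, Fin.ext_iff]
    constructor
    · rintro ⟨hj, hlt⟩
      by_cases hji : j.val = i.val
      · exact Or.inl hji
      · exact Or.inr ⟨hj, by omega⟩
    · rintro (hj | ⟨hj, hlt⟩)
      · exact ⟨by rwa [Fin.ext hj], by omega⟩
      · exact ⟨hj, by omega⟩
  · rw [add_zero]
    congr 1
    ext j
    simp only [Finset.mem_filter]
    refine and_congr_right fun hj => ?_
    have : j.val ≠ i.val := fun e => h (by rwa [← Fin.ext e])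
    omega

/-- The `i`-th edge of the path that starts at `v` and then visits the entries of `w`. -/
def pathEdge {V : Type*} {n : ℕ} (v : V) (w : Fin n → V) (i : Fin n) : V × V :=
  ((Fin.cons v w : Fin (n + 1) → V) i.castSucc, w i)

/-- The positions at which a word, preceded by the letter `0`, changes its letter. -/
def switches {n : ℕ} (x : Fin n → Fin 2) : Finset (Fin n) :=
  Finset.univ.filter fun i => (pathEdge 0 x i).1 ≠ (pathEdge 0 x i).2

theorem mem_switches {n : ℕ} (x : Fin n → Fin 2) (i : Fin n) :
    i ∈ switches x ↔ (pathEdge 0 x i).1 ≠ (pathEdge 0 x i).2 :=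
  Finset.mem_filter.trans ⟨fun h => h.2, fun h => ⟨Finset.mem_univ _, h⟩⟩

/-- Each switch flips the letter, starting from 0. Hence the switch set determines the word. -/
theorem countLT_switches_mod_two {n : ℕ} (x : Fin n → Fin 2) (i : Fin (n + 1)) :
    countLT (switches x) i % 2 = ((Fin.cons 0 x : Fin (n + 1) → Fin 2) i).val := by
  induction i using Fin.induction with
  | zero => simp [countLT_zero]
  | succ i ih =>
    rw [Fin.val_succ, countLT_succ, Fin.cons_succ]
    have hmem : i ∈ switches x ↔ (Fin.cons 0 x : Fin (n + 1) → Fin 2) i.castSucc ≠ x i :=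
      mem_switches x i
    rw [Fin.val_castSucc] at ih
    split_ifs with h
    · have := Fin.val_ne_of_ne (hmem.1 h)
      omega
    · have := congrArg Fin.val (not_not.1 (mt hmem.2 h))
      omega

theorem switches_injective (n : ℕ) : Function.Injective (switches (n := n)) := by
  intro x y h
  funext i
  have hx := countLT_switches_mod_two x i.succ
  have hy := countLT_switches_mod_two y i.succ
  rw [h] at hx
  rw [Fin.cons_succ] at hx hy
  exact Fin.ext (hx.symm.trans hy)

theorem card_filter_switches (n k : ℕ) :
    (Finset.univ.filter fun x : Fin n → Fin 2 => (switches x).card = k).card = n.choose k := by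
  have hb : Function.Bijective (switches (n := n)) :=
    (Fintype.bijective_iff_injective_and_card _).2 ⟨switches_injective n, by simp⟩
  have h : (Finset.univ.filter fun x : Fin n → Fin 2 => (switches x).card = k).map
      ⟨switches, switches_injective n⟩ = Finset.powersetCard k Finset.univ := by
    ext s
    simp only [Finset.mem_map, Finset.mem_filter, Finset.mem_univ, true_and,
      Function.Embedding.coeFn_mk, Finset.mem_powersetCard, Finset.subset_univ]
    constructor
    · rintro ⟨x, hx, rfl⟩
      exact hx
    · intro hs
      obtain ⟨x, rfl⟩ := hb.2 s
      exact ⟨x, hs, rfl⟩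
  rw [← Finset.card_map, h, Finset.card_powersetCard, Finset.card_univ, Fintype.card_fin]

/-- The word reads 1, 0, 1, 0, … along `I`. Since it is preceded by 0, the first position of `I`
also forces a switch, which gives `|I|` rather than `|I| - 1`. -/
theorem card_le_card_switches {n : ℕ} (I : Finset (Fin n)) (x : Fin n → Fin 2)
    (hx : ∀ i ∈ I, (x i).val = countLT I (i + 1) % 2) : I.card ≤ (switches x).card := by
  have key : ∀ t : Fin (n + 1), countLT I t ≤ countLT (switches x) t := by
    intro t
    induction t using Fin.induction with
    | zero => simp [countLT_zero]
    | succ i ih =>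
      have hpar := countLT_switches_mod_two x i.succ
      rw [Fin.cons_succ] at hpar
      rw [Fin.val_castSucc] at ih
      rw [Fin.val_succ] at hpar ⊢
      have h1 := countLT_succ I i
      have h2 := countLT_succ (switches x) i
      -- At a position of `I` both counts up to and including `i` have the parity of `x i`; the
      -- switch count is at most one behind, so it is not behind at all.
      by_cases hi : i ∈ I
      · have := hx i hi
        rw [if_pos hi] at h1
        split_ifs at h2 <;> omega
      · rw [if_neg hi] at h1
        split_ifs at h2 <;> omega
  have := key (Fin.last n)
  rwa [Fin.val_last, countLT_length, countLT_length] at this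

theorem vcDim_le {n k : ℕ} (C : Finset (Fin n → Fin 2))
    (hC : ∀ x ∈ C, (switches x).card ≤ k) : vcDim C ≤ k := by
  refine Finset.sup_le fun I hI => ?_
  have hI : projection C I = Finset.univ := (Finset.mem_filter.1 hI).2
  have hmem : (fun i : I => (⟨countLT I (i + 1) % 2, Nat.mod_lt _ two_pos⟩ : Fin 2))
      ∈ projection C I := hI ▸ Finset.mem_univ _
  obtain ⟨x, hxC, hx⟩ := Finset.mem_image.1 hmem
  refine (card_le_card_switches I x fun i hi => ?_).trans (hC x hxC)
  simpa using congrArg Fin.val (congrFun hx ⟨i, hi⟩)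

theorem rate_le_one {n : ℕ} (C : Finset (Fin n → Fin 2)) : rate C ≤ 1 := by
  unfold rate
  have hcard : (C.card : ℝ) ≤ 2 ^ n := by
    have := C.card_le_univ
    rw [Fintype.card_fun, Fintype.card_fin, Fintype.card_fin] at this
    exact_mod_cast this
  rcases Nat.eq_zero_or_pos n with rfl | hn
  · simp
  rcases Nat.eq_zero_or_pos C.card with h0 | hpos
  · simp [h0]
  · rw [div_le_one (by exact_mod_cast hn), Real.logb_le_iff_le_rpow one_lt_two
      (by exact_mod_cast hpos), Real.rpow_natCast]
    exact hcard

theorem bddAbove_achievable (d δ : ℝ) : BddAbove {R | Achievable d δ R} := by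
  refine ⟨1, fun R hR => ?_⟩
  obtain ⟨n, C, -, hC, -⟩ := hR.nonempty
  exact hC.trans (rate_le_one C)

/-! ### Method of types for paths -/

/-- Rows may sum to less than one because normalising an empty row of frequencies gives 0/0 = 0. -/
theorem sum_prod_pathEdge_le_one {V : Type*} [Fintype V] (q : V → V → ℝ)
    (hq : ∀ u v, 0 ≤ q u v) (hsum : ∀ u, ∑ v, q u v ≤ 1) (n : ℕ) (v₀ : V) :
    ∑ w : Fin n → V, ∏ i, q (pathEdge v₀ w i).1 (pathEdge v₀ w i).2 ≤ 1 := by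
  induction n generalizing v₀ with
  | zero => simp
  | succ n ih =>
    rw [← (Fin.consEquiv fun _ => V).sum_comp, Fintype.sum_prod_type]
    refine le_trans (Finset.sum_le_sum fun v _ => ?_) (hsum v₀)
    have h : ∀ w : Fin n → V, ∏ i, q (pathEdge v₀ (Fin.cons v w : Fin (n + 1) → V) i).1
        (pathEdge v₀ (Fin.cons v w : Fin (n + 1) → V) i).2
        = q v₀ v * ∏ i, q (pathEdge v w i).1 (pathEdge v w i).2 := by
      intro w
      rw [Fin.prod_univ_succ]
      congr 1
    calc _ = ∑ w : Fin n → V, q v₀ v * ∏ i, q (pathEdge v w i).1 (pathEdge v w i).2 :=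
          Finset.sum_congr rfl fun w _ => h w
      _ = q v₀ v * ∑ w : Fin n → V, ∏ i, q (pathEdge v w i).1 (pathEdge v w i).2 := by
          rw [Finset.mul_sum]
      _ ≤ q v₀ v := mul_le_of_le_one_right (hq _ _) (ih v)

/-- The conditional entropy of the second coordinate given the first one, for weights `p`. -/
noncomputable def pairEntropy {V : Type*} [Fintype V] (p : V → V → ℝ) : ℝ :=
  -∑ u, ∑ v, p u v * Real.logb 2 (p u v / ∑ v', p u v')

/-- The relative frequencies of the edges of a path. -/
noncomputable def edgeFreq {V : Type*} [DecidableEq V] {n : ℕ} (v₀ : V) (w : Fin n → V)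
    (u v : V) : ℝ :=
  ((Finset.univ.filter fun i => pathEdge v₀ w i = (u, v)).card : ℝ) / n

theorem edgeFreq_nonneg {V : Type*} [DecidableEq V] {n : ℕ} (v₀ : V) (w : Fin n → V) (u v : V) :
    0 ≤ edgeFreq v₀ w u v := by
  unfold edgeFreq; positivity

theorem prod_pathEdge_eq {V : Type*} [Fintype V] [DecidableEq V] {n : ℕ} (hn : 0 < n) (v₀ : V)
    (w : Fin n → V) :
    ∏ i, edgeFreq v₀ w (pathEdge v₀ w i).1 (pathEdge v₀ w i).2 /
      ∑ v', edgeFreq v₀ w (pathEdge v₀ w i).1 v' =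
    (2 : ℝ) ^ (-(n * pairEntropy (edgeFreq v₀ w))) := by
  let q : V × V → ℝ := fun e => edgeFreq v₀ w e.1 e.2 / ∑ v', edgeFreq v₀ w e.1 v'
  have hn' : (n : ℝ) ≠ 0 := by exact_mod_cast hn.ne'
  have h1 : ∏ i, q (pathEdge v₀ w i)
      = ∏ e : V × V, q e ^ (Finset.univ.filter fun i => pathEdge v₀ w i = e).card := by
    rw [← Finset.prod_fiberwise Finset.univ (fun i => pathEdge v₀ w i)]
    refine Finset.prod_congr rfl fun e _ => ?_
    rw [← Finset.prod_const]
    exact Finset.prod_congr rfl fun i hi => by rw [(Finset.mem_filter.1 hi).2]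
  have h2 : ∀ e : V × V, q e ^ (Finset.univ.filter fun i => pathEdge v₀ w i = e).card
      = (2 : ℝ) ^ (n * (edgeFreq v₀ w e.1 e.2 * Real.logb 2 (q e))) := by
    intro e
    have hcard : ((Finset.univ.filter fun i => pathEdge v₀ w i = e).card : ℝ)
        = n * edgeFreq v₀ w e.1 e.2 := by
      rw [edgeFreq]; field_simp
    rcases Nat.eq_zero_or_pos (Finset.univ.filter fun i => pathEdge v₀ w i = e).card with h | h
    · rw [h]
      rw [h, Nat.cast_zero] at hcard
      rw [← mul_assoc, ← hcard]
      simp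
    · have hf : 0 < edgeFreq v₀ w e.1 e.2 := by
        have : (0 : ℝ) < (Finset.univ.filter fun i => pathEdge v₀ w i = e).card := by
          exact_mod_cast h
        exact div_pos this (by exact_mod_cast hn)
      have hq : 0 < q e := div_pos hf (lt_of_lt_of_le hf
        (Finset.single_le_sum (f := fun v => edgeFreq v₀ w e.1 v)
          (fun v _ => edgeFreq_nonneg _ _ _ _) (Finset.mem_univ e.2)))
      rw [← Real.rpow_natCast, hcard, ← mul_assoc, mul_comm (_ * _), Real.rpow_mul two_pos.le,
        Real.rpow_logb two_pos (by norm_num) hq]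
  change ∏ i, q (pathEdge v₀ w i) = _
  rw [h1, Finset.prod_congr rfl fun e _ => h2 e, ← Real.rpow_sum_of_pos two_pos]
  congr 1
  rw [pairEntropy, ← Finset.mul_sum, Fintype.sum_prod_type]
  ring

/-- With transition probabilities given by the normalised rows of `p`, each path of type `p` has
probability exactly `2 ^ (-n * pairEntropy p)`, and these probabilities sum to at most one. -/
theorem card_le_of_edgeFreq_eq {V : Type*} [Fintype V] [DecidableEq V] {n : ℕ} (hn : 0 < n)
    (v₀ : V) (S : Finset (Fin n → V)) (p : V → V → ℝ) (hS : ∀ w ∈ S, edgeFreq v₀ w = p) :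
    (S.card : ℝ) ≤ 2 ^ (n * pairEntropy p) := by
  rcases S.eq_empty_or_nonempty with rfl | ⟨w₀, hw₀⟩
  · simp; positivity
  have hp : ∀ u v, 0 ≤ p u v := fun u v => hS w₀ hw₀ ▸ edgeFreq_nonneg _ _ _ _
  have h := sum_prod_pathEdge_le_one (fun u v => p u v / ∑ v', p u v')
    (fun u v => div_nonneg (hp _ _) (Finset.sum_nonneg fun _ _ => hp _ _))
    (fun u => by rw [← Finset.sum_div]; exact div_self_le_one _) n v₀
  have h2 : ∑ w ∈ S, (2 : ℝ) ^ (-(n * pairEntropy p)) ≤ 1 := by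
    refine le_trans ?_ h
    refine le_trans (Finset.sum_le_sum fun w hw => ?_)
      (Finset.sum_le_univ_sum_of_nonneg fun w => Finset.prod_nonneg fun i _ =>
        div_nonneg (hp _ _) (Finset.sum_nonneg fun _ _ => hp _ _))
    have := prod_pathEdge_eq hn v₀ w
    rw [hS w hw] at this
    exact this.ge
  rw [Finset.sum_const, nsmul_eq_mul, Real.rpow_neg two_pos.le,
    ← div_eq_mul_inv, div_le_one (by positivity)] at h2
  exact h2

theorem card_le_of_pairEntropy_le {V : Type*} [Fintype V] [DecidableEq V] {n : ℕ} (hn : 0 < n)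
    (v₀ : V) (S : Finset (Fin n → V)) (c : ℝ)
    (hS : ∀ w ∈ S, pairEntropy (edgeFreq v₀ w) ≤ c) :
    (S.card : ℝ) ≤ (n + 1) ^ (Fintype.card V * Fintype.card V) * 2 ^ (n * c) := by
  let type : (Fin n → V) → V → V → Fin (n + 1) := fun w u v =>
    ⟨(Finset.univ.filter fun i => pathEdge v₀ w i = (u, v)).card,
      Nat.lt_succ_of_le ((Finset.card_le_univ _).trans (by simp))⟩
  have htype : ∀ w w', type w = type w' → edgeFreq v₀ w = edgeFreq v₀ w' := by
    intro w w' h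
    funext u v
    have := congrArg Fin.val (congrFun (congrFun h u) v)
    simp only [type] at this
    rw [edgeFreq, edgeFreq, this]
  -- Group the paths by type; each edge count takes at most n + 1 values.
  have h1 : S.card ≤ ⌊(2 : ℝ) ^ (n * c)⌋₊ * (S.image type).card := by
    refine Finset.card_le_mul_card_image S _ fun t ht => Nat.le_floor ?_
    obtain ⟨w₀, hw₀, rfl⟩ := Finset.mem_image.1 ht
    refine (card_le_of_edgeFreq_eq hn v₀ _ (edgeFreq v₀ w₀)
      fun w hw => htype _ _ (Finset.mem_filter.1 hw).2).trans ?_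
    exact Real.rpow_le_rpow_of_exponent_le one_le_two
      (mul_le_mul_of_nonneg_left (hS w₀ hw₀) (Nat.cast_nonneg n))
  have h2 : (S.image type).card ≤ (n + 1) ^ (Fintype.card V * Fintype.card V) := by
    refine (Finset.card_le_univ _).trans_eq ?_
    simp [pow_mul]
  calc (S.card : ℝ) ≤ ⌊(2 : ℝ) ^ (n * c)⌋₊ * (S.image type).card := by exact_mod_cast h1
    _ ≤ 2 ^ (n * c) * (n + 1) ^ (Fintype.card V * Fintype.card V) := by
        refine mul_le_mul (Nat.floor_le (by positivity)) (by exact_mod_cast h2) (by positivity)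
          (by positivity)
    _ = _ := mul_comm _ _

/-- The empirical distribution of a sequence. -/
noncomputable def empirical {E : Type*} [DecidableEq E] {n : ℕ} (e : Fin n → E) (a : E) : ℝ :=
  ((Finset.univ.filter fun i => e i = a).card : ℝ) / n

theorem sum_empirical_mul {E : Type*} [Fintype E] [DecidableEq E] {n : ℕ} (e : Fin n → E)
    (g : E → ℝ) : ∑ a, empirical e a * g a = (∑ i, g (e i)) / n := by
  rw [← Finset.sum_fiberwise Finset.univ e, Finset.sum_div]
  refine Finset.sum_congr rfl fun a _ => ?_
  rw [Finset.sum_congr rfl fun i hi => by rw [(Finset.mem_filter.1 hi).2], Finset.sum_const,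
    nsmul_eq_mul, empirical]
  ring

theorem sum_filter_empirical {E : Type*} [Fintype E] [DecidableEq E] {n : ℕ} (e : Fin n → E)
    (r : E → Prop) [DecidablePred r] :
    ∑ a with r a, empirical e a = ((Finset.univ.filter fun i => r (e i)).card : ℝ) / n := by
  have h := sum_empirical_mul e fun a => if r a then 1 else 0
  simp only [mul_ite, mul_one, mul_zero, ← Finset.sum_filter] at h
  rw [h, Finset.sum_const, nsmul_one]

/-- Sources and targets list the same vertices, except for the first source and the last target. -/
theorem abs_card_source_sub_card_target_le {V : Type*} [DecidableEq V] {n : ℕ} (v₀ : V)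
    (w : Fin n → V) (u : V) :
    |((Finset.univ.filter fun i => (pathEdge v₀ w i).1 = u).card : ℝ) -
      (Finset.univ.filter fun i => (pathEdge v₀ w i).2 = u).card| ≤ 1 := by
  let g : Fin (n + 1) → ℝ := fun i => if (Fin.cons v₀ w : Fin (n + 1) → V) i = u then 1 else 0
  have h1 : ((Finset.univ.filter fun i => (pathEdge v₀ w i).1 = u).card : ℝ)
      = ∑ i : Fin n, g i.castSucc := by
    simp only [g, pathEdge, Finset.sum_boole]; rfl
  have h2 : ((Finset.univ.filter fun i => (pathEdge v₀ w i).2 = u).card : ℝ)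
      = ∑ i : Fin n, g i.succ := by
    simp only [g, pathEdge, Finset.sum_boole, Fin.cons_succ]; rfl
  have h3 : ∑ i : Fin n, g i.castSucc + g (Fin.last n) = g 0 + ∑ i : Fin n, g i.succ := by
    rw [← Fin.sum_univ_castSucc, Fin.sum_univ_succ]
  have hg : ∀ i, 0 ≤ g i ∧ g i ≤ 1 := by
    intro i
    simp only [g]
    split_ifs <;> norm_num
  rw [h1, h2, abs_le]
  have := hg 0
  have := hg (Fin.last n)
  constructor <;> linarith

/-- Joint minus marginal entropy: this form has no quotient, so continuity is visible even where a
row has mass zero. -/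
theorem pairEntropy_eq {V : Type*} [Fintype V] (p : V → V → ℝ) (hp : ∀ u v, 0 ≤ p u v) :
    pairEntropy p = (∑ u, ∑ v, Real.negMulLog (p u v) -
      ∑ u, Real.negMulLog (∑ v, p u v)) / Real.log 2 := by
  have h : ∀ u v, p u v * Real.logb 2 (p u v / ∑ v', p u v')
      = (p u v * Real.log (p u v) - p u v * Real.log (∑ v', p u v')) / Real.log 2 := by
    intro u v
    rcases (hp u v).eq_or_lt with h0 | hpos
    · simp [← h0]
    · have : 0 < ∑ v', p u v' := hpos.trans_le
        (Finset.single_le_sum (f := p u) (fun v _ => hp u v) (Finset.mem_univ v))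
      rw [Real.logb, Real.log_div hpos.ne' this.ne']
      ring
  simp only [pairEntropy, h, Real.negMulLog, ← Finset.sum_div, Finset.sum_sub_distrib,
    ← Finset.sum_mul, neg_mul, Finset.sum_neg_distrib]
  ring

/-! ### Continuity of the conditional entropy -/

section Chains

variable {V E A : Type} [Fintype V] [DecidableEq V] [Fintype E] (G : LabeledGraph V E A)

theorem condEntropy_eq_pairEntropy (P : E → ℝ) :
    condEntropy G P = pairEntropy (jointProb G P) := rfl

omit [Fintype V] in
theorem jointProb_nonneg {P : E → ℝ} (hP : ∀ e, 0 ≤ P e) (u v : V) : 0 ≤ jointProb G P u v :=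
  Finset.sum_nonneg fun e _ => hP e

theorem continuousOn_condEntropy : ContinuousOn (condEntropy G) (Set.Icc 0 1) := by
  have hj : ∀ u v, Continuous fun P : E → ℝ => jointProb G P u v := by
    intro u v
    unfold jointProb
    fun_prop
  have hc : Continuous fun P : E → ℝ => (∑ u, ∑ v, Real.negMulLog (jointProb G P u v) -
      ∑ u, Real.negMulLog (∑ v, jointProb G P u v)) / Real.log 2 := by
    have := Real.continuous_negMulLog
    fun_prop
  refine hc.continuousOn.congr fun P hP => ?_
  rw [condEntropy_eq_pairEntropy, pairEntropy_eq _ (jointProb_nonneg G hP.1)]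

theorem bddAbove_condEntropy {W : Type} [AddCommGroup W] [Module ℝ W] (f : E → W) (U : Set W) :
    BddAbove (condEntropy G '' chains G f U) := by
  refine ((isCompact_Icc (a := (0 : E → ℝ)) (b := 1)).image_of_continuousOn
    (continuousOn_condEntropy G)).bddAbove.mono (Set.image_mono fun P hP => ?_)
  exact ⟨fun e => (hP.1.mem_Icc e).1, fun e => (hP.1.mem_Icc e).2⟩

end Chains

/-! ### Upper bound for F -/

section TwoState

open State

theorem sum_state {M : Type*} [AddCommMonoid M] (g : State → M) : ∑ u, g u = g a + g b := by
  have : (Finset.univ : Finset State) = {a, b} := rfl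
  rw [this, Finset.sum_pair (by decide)]

theorem jointProb_twoState (P : State × State → ℝ) (u v : State) :
    jointProb twoState P u v = P (u, v) := by
  have : (Finset.univ.filter fun e => twoState.src e = u ∧ twoState.tgt e = v) = {(u, v)} := by
    ext ⟨x, y⟩
    simp only [Finset.mem_filter, Finset.mem_univ, true_and]
    simp [twoState]
  rw [jointProb, this, Finset.sum_singleton]

/-- One term of Gibbs' inequality, from log t ≤ t - 1 at t = sq/x. The corrections `s * q - x`
cancel over a row in which the `q` sum to one and the `x` to `s`. -/
theorem mul_logb_div_ge {x s q : ℝ} (hx : 0 ≤ x) (hxs : x ≤ s) (hq : 0 ≤ q)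
    (h : q = 0 → x = 0) :
    -(x * Real.logb 2 (x / s)) ≤ -(x * Real.log q / Real.log 2) + (s * q - x) / Real.log 2 := by
  have hl : 0 < Real.log 2 := Real.log_pos one_lt_two
  rcases hx.eq_or_lt with rfl | hx
  · simp; positivity
  have hq' : 0 < q := hq.lt_of_ne fun e => hx.ne' (h e.symm)
  have hs : 0 < s := hx.trans_le hxs
  have key := Real.log_le_sub_one_of_pos (x := s * q / x) (by positivity)
  rw [Real.log_div (by positivity) hx.ne', Real.log_mul hs.ne' hq'.ne'] at key
  have key2 := mul_le_mul_of_nonneg_left key hx.le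
  have e : x * (s * q / x - 1) = s * q - x := by field_simp
  rw [e] at key2
  rw [Real.logb, Real.log_div hx.ne' hs.ne', ← mul_div_assoc, ← neg_div, ← neg_div, ← add_div]
  refine div_le_div_of_nonneg_right ?_ hl.le
  linarith

/-- Gibbs' inequality against the transition law that switches with probability `p` from either
state. -/
theorem condEntropy_twoState_le {p : ℝ} (hp : p ∈ Set.Icc (0 : ℝ) 1) {P : State × State → ℝ}
    (hP : P ∈ chains twoState switch {p}) :
    condEntropy twoState P ≤ Real.binEntropy p / Real.log 2 := by
  obtain ⟨hM, hE⟩ := hP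
  have h0 := fun e => (hM.mem_Icc e).1
  have hsum := hM.sum_eq_one
  have hE : expect P switch = p := hE
  simp only [expect, switch, Fintype.sum_prod_type, sum_state, smul_eq_mul] at hE hsum
  simp at hE
  have hq : 0 ≤ 1 - p := by linarith [hp.2]
  have haa := h0 (a, a)
  have hab := h0 (a, b)
  have hba := h0 (b, a)
  have hbb := h0 (b, b)
  have g1 := mul_logb_div_ge haa (le_add_of_nonneg_right hab) hq (fun h => by linarith)
  have g2 := mul_logb_div_ge hab (le_add_of_nonneg_left haa) hp.1 (fun h => by linarith)
  have g3 := mul_logb_div_ge hba (le_add_of_nonneg_right hbb) hp.1 (fun h => by linarith)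
  have g4 := mul_logb_div_ge hbb (le_add_of_nonneg_left hba) hq (fun h => by linarith)
  rw [condEntropy_eq_pairEntropy, pairEntropy]
  simp only [sum_state, jointProb_twoState]
  have e : Real.binEntropy p / Real.log 2 =
      -(P (a, a) * Real.log (1 - p) / Real.log 2)
      + -(P (a, b) * Real.log p / Real.log 2) + -(P (b, a) * Real.log p / Real.log 2)
      + -(P (b, b) * Real.log (1 - p) / Real.log 2) := by
    have e1 : P (a, a) + P (b, b) = 1 - p := by linarith
    rw [Real.binEntropy, Real.log_inv, Real.log_inv, ← e1]
    nth_rewrite 1 [← hE]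
    ring
  have e2 : ((P (a, a) + P (a, b)) * (1 - p) - P (a, a)) / Real.log 2
      + ((P (a, a) + P (a, b)) * p - P (a, b)) / Real.log 2
      + ((P (b, a) + P (b, b)) * p - P (b, a)) / Real.log 2
      + ((P (b, a) + P (b, b)) * (1 - p) - P (b, b)) / Real.log 2 = 0 := by ring
  linarith

/-- The stationary chain with uniform marginals that switches with probability `p`. -/
noncomputable def symmetricChain (p : ℝ) (e : State × State) : ℝ :=
  if e.1 = e.2 then (1 - p) / 2 else p / 2

/-- Two identical copies of the chain `symmetricChain p`. -/
noncomputable def diagonalChain (p : ℝ) (e : (State × State) × (State × State)) : ℝ :=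
  if e.1 = e.2 then symmetricChain p e.1 else 0

theorem sum_diagonalChain_mul (p : ℝ) (g : (State × State) × (State × State) → ℝ) :
    ∑ e, diagonalChain p e * g e = ∑ e, symmetricChain p e * g (e, e) := by
  rw [Fintype.sum_prod_type]
  refine Finset.sum_congr rfl fun e _ => ?_
  simp [diagonalChain, ite_mul]

theorem entropyF_le {p : ℝ} (hp : p ∈ Set.Icc (0 : ℝ) 1) :
    entropyF {p} ≤ Real.binEntropy p / Real.log 2 := by
  refine Real.sSup_le ?_ (div_nonneg (Real.binEntropy_nonneg hp.1 hp.2)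
    (Real.log_nonneg one_le_two))
  rintro _ ⟨P, hP, rfl⟩
  exact condEntropy_twoState_le hp hP

end TwoState

/-! ### Stability of G under small perturbations of the constraints -/

theorem IsStationaryMarkovChain.of_nonneg {V E A : Type} [Fintype V] [DecidableEq V] [Fintype E]
    {G : LabeledGraph V E A} {P : E → ℝ} (h0 : ∀ e, 0 ≤ P e) (h1 : ∑ e, P e = 1)
    (hb : ∀ u : V, ∑ e with G.src e = u, P e = ∑ e with G.tgt e = u, P e) :
    IsStationaryMarkovChain G P :=
  ⟨fun e => ⟨h0 e, h1 ▸ Finset.single_le_sum (fun e _ => h0 e) (Finset.mem_univ e)⟩, h1, hb⟩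

theorem IsStationaryMarkovChain.mix {V E A : Type} [Fintype V] [DecidableEq V] [Fintype E]
    {G : LabeledGraph V E A} {P Q : E → ℝ} (hP : IsStationaryMarkovChain G P)
    (hQ : IsStationaryMarkovChain G Q) {t : ℝ} (ht : t ∈ Set.Icc (0 : ℝ) 1) :
    IsStationaryMarkovChain G fun e => (1 - t) * P e + t * Q e := by
  refine .of_nonneg (fun e => ?_) ?_ fun u => ?_
  · exact add_nonneg (mul_nonneg (sub_nonneg.2 ht.2) (hP.mem_Icc e).1)
      (mul_nonneg ht.1 (hQ.mem_Icc e).1)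
  · rw [Finset.sum_add_distrib, ← Finset.mul_sum, ← Finset.mul_sum, hP.sum_eq_one, hQ.sum_eq_one]
    ring
  · simp only [Finset.sum_add_distrib, ← Finset.mul_sum, hP.balance u, hQ.balance u]

theorem expect_switchDisagree (P : (State × State) × (State × State) → ℝ) :
    expect P switchDisagree
      = (∑ e, P e * switch e.1, ∑ e, P e * switch e.2, ∑ e, P e * disagree e) := by
  simp [expect, switchDisagree, Prod.ext_iff, Prod.fst_sum, Prod.snd_sum]

theorem mem_chains_prod {P : (State × State) × (State × State) → ℝ} {p δ : ℝ} :
    P ∈ chains (twoState.prod twoState) switchDisagree ({p} ×ˢ {p} ×ˢ Set.Ico 0 δ) ↔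
      IsStationaryMarkovChain (twoState.prod twoState) P ∧ ∑ e, P e * switch e.1 = p ∧
        ∑ e, P e * switch e.2 = p ∧ 0 ≤ ∑ e, P e * disagree e ∧ ∑ e, P e * disagree e < δ := by
  simp only [chains, Set.mem_ofPred_eq, expect_switchDisagree, Set.mem_prod, Set.mem_singleton_iff,
    Set.mem_Ico]

theorem disagree_nonneg (e : (State × State) × (State × State)) : 0 ≤ disagree e := by
  unfold disagree
  split_ifs <;> norm_num

theorem sum_symmetricChain_mul_switch (p : ℝ) :
    ∑ e, symmetricChain p e * switch e = p := by
  simp [Fintype.sum_prod_type, sum_state, symmetricChain, switch]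

theorem isStationaryMarkovChain_diagonalChain {p : ℝ} (hp : p ∈ Set.Icc (0 : ℝ) 1) :
    IsStationaryMarkovChain (twoState.prod twoState) (diagonalChain p) := by
  refine .of_nonneg (fun e => ?_) ?_ fun u => ?_
  · have h1 := hp.1
    have h2 := sub_nonneg.2 hp.2
    unfold diagonalChain symmetricChain
    split_ifs <;> positivity
  · have := sum_diagonalChain_mul p fun _ => 1
    simp only [mul_one] at this
    rw [this]
    simp [Fintype.sum_prod_type, sum_state, symmetricChain]
    ring
  · have h : ∀ (r : (State × State) × (State × State) → Prop) [DecidablePred r],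
        ∑ e with r e, diagonalChain p e = ∑ e, symmetricChain p e * if r (e, e) then 1 else 0 := by
      intro r _
      rw [← sum_diagonalChain_mul p fun e => if r e then 1 else 0, Finset.sum_filter]
      simp
    rw [h, h]
    rcases u with ⟨u | u, v | v⟩ <;>
      simp [Fintype.sum_prod_type, sum_state, symmetricChain, LabeledGraph.prod, twoState]

/-- G is defined with disagreement strictly below `δ`, while compactness needs the closed condition.
Mixing in a little of the diagonal chain, which never disagrees, makes the inequality strict; then
let its weight tend to zero. -/
theorem condEntropy_le_entropyG {p δ : ℝ} (hp : p ∈ Set.Icc (0 : ℝ) 1) (hδ : 0 < δ)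
    {P : (State × State) × (State × State) → ℝ}
    (hP : IsStationaryMarkovChain (twoState.prod twoState) P)
    (h1 : ∑ e, P e * switch e.1 = p) (h2 : ∑ e, P e * switch e.2 = p)
    (hΔ : ∑ e, P e * disagree e ≤ δ) :
    condEntropy (twoState.prod twoState) P ≤ entropyG {p} δ := by
  have hD := isStationaryMarkovChain_diagonalChain hp
  have hD1 : ∑ e, diagonalChain p e * switch e.1 = p := by
    rw [sum_diagonalChain_mul p fun e => switch e.1]
    exact sum_symmetricChain_mul_switch p
  have hD2 : ∑ e, diagonalChain p e * switch e.2 = p := by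
    rw [sum_diagonalChain_mul p fun e => switch e.2]
    exact sum_symmetricChain_mul_switch p
  have hDΔ : ∑ e, diagonalChain p e * disagree e = 0 := by
    rw [sum_diagonalChain_mul]
    simp [disagree]
  let mix : ℝ → (State × State) × (State × State) → ℝ :=
    fun t e => (1 - t) * P e + t * diagonalChain p e
  have hmix : ∀ (t : ℝ) (g : (State × State) × (State × State) → ℝ),
      ∑ e, mix t e * g e = (1 - t) * ∑ e, P e * g e + t * ∑ e, diagonalChain p e * g e := by
    intro t g
    simp only [mix, Finset.mul_sum, ← Finset.sum_add_distrib]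
    exact Finset.sum_congr rfl fun e _ => by ring
  have hPΔ : 0 ≤ ∑ e, P e * disagree e :=
    Finset.sum_nonneg fun e _ => mul_nonneg (hP.mem_Icc e).1 (disagree_nonneg e)
  have hstat : ∀ t ∈ Set.Icc (0 : ℝ) 1,
      IsStationaryMarkovChain (twoState.prod twoState) (mix t) := fun t ht => hP.mix hD ht
  have hle : ∀ t ∈ Set.Ioc (0 : ℝ) 1,
      condEntropy (twoState.prod twoState) (mix t) ≤ entropyG {p} δ := by
    intro t ht
    refine le_csSup (bddAbove_condEntropy _ _ _) ⟨mix t, mem_chains_prod.2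
      ⟨hstat t ⟨ht.1.le, ht.2⟩, ?_, ?_, ?_, ?_⟩, rfl⟩
    · rw [hmix t fun e => switch e.1, h1, hD1]; ring
    · rw [hmix t fun e => switch e.2, h2, hD2]; ring
    · rw [hmix t, hDΔ, mul_zero, add_zero]
      exact mul_nonneg (sub_nonneg.2 ht.2) hPΔ
    · rw [hmix t, hDΔ]
      nlinarith [ht.1, ht.2]
  have hcont : ContinuousOn (fun t => condEntropy (twoState.prod twoState) (mix t))
      (Set.Icc 0 1) := by
    refine (continuousOn_condEntropy (twoState.prod twoState)).comp ?_ fun t ht => ?_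
    · refine Continuous.continuousOn ?_
      fun_prop
    · exact ⟨fun e => ((hstat t ht).mem_Icc e).1, fun e => ((hstat t ht).mem_Icc e).2⟩
  have hlim := (hcont 0 ⟨le_rfl, zero_le_one⟩).mono Set.Ioc_subset_Icc_self
  have hmix0 : mix 0 = P := by
    funext e
    simp [mix]
  have : (nhdsWithin (0 : ℝ) (Set.Ioc 0 1)).NeBot := by
    rw [nhdsWithin_Ioc_eq_nhdsGT zero_lt_one]
    infer_instance
  have := le_of_tendsto hlim (Filter.eventually_of_mem self_mem_nhdsWithin hle)
  exact hmix0 ▸ this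

/-- The distributions with entropy at least G + ε and disagreement at most `δ` form a compact set
`A`. The total violation `Φ` of the equality constraints is continuous and, by
`condEntropy_le_entropyG`, positive on `A`, so it is bounded away from zero there. -/
theorem exists_condEntropy_le_entropyG_add {p δ ε : ℝ} (hp : p ∈ Set.Icc (0 : ℝ) 1) (hδ : 0 < δ)
    (hε : 0 < ε) : ∃ η > 0, ∀ P : (State × State) × (State × State) → ℝ,
      (∀ e, 0 ≤ P e) → ∑ e, P e = 1 →
      (∀ u, |∑ e with (twoState.prod twoState).src e = u, P e -
        ∑ e with (twoState.prod twoState).tgt e = u, P e| ≤ η) →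
      |∑ e, P e * switch e.1 - p| ≤ η → |∑ e, P e * switch e.2 - p| ≤ η →
      ∑ e, P e * disagree e ≤ δ →
      condEntropy (twoState.prod twoState) P ≤ entropyG {p} δ + ε := by
  let H := condEntropy (twoState.prod twoState)
  let A : Set ((State × State) × (State × State) → ℝ) :=
    ((Set.Icc 0 1 ∩ H ⁻¹' Set.Ici (entropyG {p} δ + ε)) ∩ {P | ∑ e, P e = 1}) ∩
      {P | ∑ e, P e * disagree e ≤ δ}
  have hA : IsCompact A := by
    refine IsCompact.inter_right (IsCompact.inter_right ?_ ?_) ?_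
    · exact isCompact_Icc.of_isClosed_subset
        ((continuousOn_condEntropy _).preimage_isClosed_of_isClosed isClosed_Icc isClosed_Ici)
        Set.inter_subset_left
    · exact isClosed_eq (by fun_prop) (by fun_prop)
    · exact isClosed_le (by fun_prop) (by fun_prop)
  let Φ : ((State × State) × (State × State) → ℝ) → ℝ := fun P =>
    ∑ u, |∑ e with (twoState.prod twoState).src e = u, P e -
        ∑ e with (twoState.prod twoState).tgt e = u, P e| +
      |∑ e, P e * switch e.1 - p| + |∑ e, P e * switch e.2 - p|
  have hΦ : Continuous Φ := by
    refine ((continuous_finsetSum _ fun u _ => Continuous.abs ?_).add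
      (Continuous.abs ?_)).add (Continuous.abs ?_) <;> fun_prop
  have hpos : ∀ P ∈ A, 0 < Φ P := by
    rintro P ⟨⟨⟨hI, hH⟩, hs⟩, hd⟩
    have hsn : 0 ≤ ∑ u, |∑ e with (twoState.prod twoState).src e = u, P e -
        ∑ e with (twoState.prod twoState).tgt e = u, P e| :=
      Finset.sum_nonneg fun _ _ => abs_nonneg _
    by_contra! hle
    have ha := abs_nonneg (∑ e, P e * switch e.1 - p)
    have hb := abs_nonneg (∑ e, P e * switch e.2 - p)
    simp only [Φ] at hle
    have h1 : |∑ e, P e * switch e.1 - p| = 0 := by linarith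
    have h2 : |∑ e, P e * switch e.2 - p| = 0 := by linarith
    have h3 := (Finset.sum_eq_zero_iff_of_nonneg fun _ _ => abs_nonneg _).1
      (le_antisymm (by linarith) hsn)
    have hst : IsStationaryMarkovChain (twoState.prod twoState) P :=
      .of_nonneg hI.1 hs fun u => sub_eq_zero.1 (abs_eq_zero.1 (h3 u (Finset.mem_univ u)))
    have := condEntropy_le_entropyG hp hδ hst (sub_eq_zero.1 (abs_eq_zero.1 h1))
      (sub_eq_zero.1 (abs_eq_zero.1 h2)) hd
    have hH : entropyG {p} δ + ε ≤ condEntropy (twoState.prod twoState) P := hH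
    linarith
  obtain ⟨c, hc, hcA⟩ := hA.exists_forall_le' hΦ.continuousOn hpos
  -- `Φ` has six terms, four balance conditions and two switch rates, and 6c/7 < c.
  refine ⟨c / 7, by linarith, fun P h0 hs hb h1 h2 hd => ?_⟩
  by_contra! hlt
  have hPA : P ∈ A := ⟨⟨⟨⟨h0, fun e =>
    (Finset.single_le_sum (fun e _ => h0 e) (Finset.mem_univ e)).trans_eq hs⟩, hlt.le⟩, hs⟩, hd⟩
  have h3 := hcA P hPA
  have h4 : ∑ u, |∑ e with (twoState.prod twoState).src e = u, P e -
        ∑ e with (twoState.prod twoState).tgt e = u, P e| ≤ 4 * (c / 7) := by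
    refine (Finset.sum_le_card_nsmul _ _ _ fun u _ => hb u).trans_eq ?_
    rw [Finset.card_univ, nsmul_eq_mul]
    norm_num [show Fintype.card (State × State) = 4 from rfl]
  simp only [Φ] at h3
  linarith

/-! ### Pairs of words as walks on the squared graph -/

open State Filter Topology

/-- The vertex whose incoming edges carry the given label. -/
def letterState (i : Fin 2) : State := if i = 0 then b else a

theorem letterState_injective : Function.Injective letterState := by decide

/-- The walk on the squared graph that spells two words. -/
def pairPath {n : ℕ} (x y : Fin n → Fin 2) (i : Fin n) : State × State :=
  (letterState (x i), letterState (y i))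

/-- The edges of the walk `pairPath`. -/
def pairEdges {n : ℕ} (x y : Fin n → Fin 2) (i : Fin n) : (State × State) × (State × State) :=
  (((pathEdge (b, b) (pairPath x y) i).1.1, (pathEdge (b, b) (pairPath x y) i).2.1),
    ((pathEdge (b, b) (pairPath x y) i).1.2, (pathEdge (b, b) (pairPath x y) i).2.2))

theorem pathEdge_comp {V W : Type*} {n : ℕ} (g : V → W) (v₀ : V) (w : Fin n → V) (i : Fin n) :
    pathEdge (g v₀) (g ∘ w) i = (g (pathEdge v₀ w i).1, g (pathEdge v₀ w i).2) := by
  have : ∀ j : Fin (n + 1), (Fin.cons (g v₀) (g ∘ w) : Fin (n + 1) → W) j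
      = g ((Fin.cons v₀ w : Fin (n + 1) → V) j) := by
    intro j
    cases j using Fin.cases <;> simp
  rw [pathEdge, this]
  rfl

theorem pairEdges_fst {n : ℕ} (x y : Fin n → Fin 2) (i : Fin n) :
    (pairEdges x y i).1
      = (letterState (pathEdge 0 x i).1, letterState (pathEdge 0 x i).2) := by
  rw [← pathEdge_comp]
  exact (pathEdge_comp Prod.fst (b, b) (pairPath x y) i).symm

theorem pairEdges_snd {n : ℕ} (x y : Fin n → Fin 2) (i : Fin n) :
    (pairEdges x y i).2
      = (letterState (pathEdge 0 y i).1, letterState (pathEdge 0 y i).2) := by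
  rw [← pathEdge_comp]
  exact (pathEdge_comp Prod.snd (b, b) (pairPath x y) i).symm

theorem sum_switch {n : ℕ} (x : Fin n → Fin 2) :
    ∑ i, switch (letterState (pathEdge 0 x i).1, letterState (pathEdge 0 x i).2)
      = (switches x).card := by
  have : ∀ i, switch (letterState (pathEdge 0 x i).1, letterState (pathEdge 0 x i).2)
      = if i ∈ switches x then 1 else 0 := by
    intro i
    simp only [switch, letterState_injective.eq_iff, mem_switches, ne_eq, ite_not]
  simp [this]

theorem sum_disagree_pairEdges {n : ℕ} (x y : Fin n → Fin 2) :
    ∑ i, disagree (pairEdges x y i) = hammingDist x y := by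
  have hl : ∀ u v w z : Fin 2, disagree ((letterState u, letterState v),
      (letterState w, letterState z)) = if v ≠ z then 1 else 0 := by
    intro u v w z
    unfold disagree
    have : twoState.label (letterState u, letterState v) ≠
        twoState.label (letterState w, letterState z) ↔ v ≠ z := by
      revert u v w z
      decide
    simp only [this]
  have : ∀ i, disagree (pairEdges x y i) = if x i ≠ y i then 1 else 0 := by
    intro i
    rw [← Prod.mk.eta (p := pairEdges x y i), pairEdges_fst, pairEdges_snd, hl]
    rfl
  simp only [this, hammingDist, Finset.sum_boole]

theorem jointProb_empirical_pairEdges {n : ℕ} (x y : Fin n → Fin 2) :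
    jointProb (twoState.prod twoState) (empirical (pairEdges x y))
      = edgeFreq (b, b) (pairPath x y) := by
  funext u v
  rw [jointProb, sum_filter_empirical, edgeFreq]
  congr 3
  ext i
  simp only [Finset.mem_filter, Finset.mem_univ, true_and]
  exact (Prod.ext_iff (x := pathEdge (b, b) (pairPath x y) i) (y := (u, v))).symm

theorem empirical_nonneg {E : Type*} [DecidableEq E] {n : ℕ} (e : Fin n → E) (c : E) :
    0 ≤ empirical e c := by
  unfold empirical; positivity

/-! ### Counting close pairs and constructing the code -/

theorem card_close_pairs_le {p δ c η : ℝ} {n k : ℕ} (hn : 0 < n) (hη : 1 / (n : ℝ) ≤ η)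
    (hk : |(k : ℝ) / n - p| ≤ η)
    (hent : ∀ P : (State × State) × (State × State) → ℝ,
      (∀ e, 0 ≤ P e) → ∑ e, P e = 1 →
      (∀ u, |∑ e with (twoState.prod twoState).src e = u, P e -
        ∑ e with (twoState.prod twoState).tgt e = u, P e| ≤ η) →
      |∑ e, P e * switch e.1 - p| ≤ η → |∑ e, P e * switch e.2 - p| ≤ η →
      ∑ e, P e * disagree e ≤ δ → condEntropy (twoState.prod twoState) P ≤ c)
    (T : Finset ((Fin n → Fin 2) × (Fin n → Fin 2)))
    (hT : ∀ z ∈ T, (switches z.1).card = k ∧ (switches z.2).card = k ∧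
      (hammingDist z.1 z.2 : ℝ) < δ * n) :
    (T.card : ℝ) ≤ (n + 1) ^ 16 * 2 ^ (n * c) := by
  have hn' : (0 : ℝ) < n := by exact_mod_cast hn
  have hinj : Function.Injective
      fun z : (Fin n → Fin 2) × (Fin n → Fin 2) => pairPath z.1 z.2 := by
    intro z z' h
    refine Prod.ext (funext fun i => ?_) (funext fun i => ?_)
    · exact letterState_injective (Prod.ext_iff.1 (congrFun h i)).1
    · exact letterState_injective (Prod.ext_iff.1 (congrFun h i)).2
  have h16 : Fintype.card (State × State) * Fintype.card (State × State) = 16 := rfl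
  have h := card_le_of_pairEntropy_le hn (b, b) (T.map ⟨_, hinj⟩) c ?_
  · rwa [Finset.card_map, h16] at h
  intro w hw
  obtain ⟨⟨x, y⟩, hz, rfl⟩ := Finset.mem_map.1 hw
  obtain ⟨hx, hy, hd⟩ := hT _ hz
  simp only [Function.Embedding.coeFn_mk]
  rw [← jointProb_empirical_pairEdges, ← condEntropy_eq_pairEntropy]
  refine hent _ (empirical_nonneg _) ?_ (fun u => ?_) ?_ ?_ ?_
  · have := sum_empirical_mul (pairEdges x y) fun _ => 1
    simp only [mul_one] at this
    rw [this]
    simp [hn'.ne']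
  · rw [sum_filter_empirical, sum_filter_empirical, ← sub_div, abs_div, abs_of_pos hn']
    refine le_trans (div_le_div_of_nonneg_right ?_ hn'.le) hη
    exact abs_card_source_sub_card_target_le (b, b) (pairPath x y) u
  · rw [sum_empirical_mul (pairEdges x y) fun e => switch e.1]
    simp only [pairEdges_fst]
    rwa [sum_switch, hx]
  · rw [sum_empirical_mul (pairEdges x y) fun e => switch e.2]
    simp only [pairEdges_snd]
    rwa [sum_switch, hy]
  · rw [sum_empirical_mul, sum_disagree_pairEdges, div_le_iff₀ hn']
    exact hd.le

theorem exists_code {p δ c η : ℝ} {n k : ℕ} (hδ : 0 < δ) (hn : 0 < n) (hkn : k ≤ n)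
    (hη : 1 / (n : ℝ) ≤ η) (hk : |(k : ℝ) / n - p| ≤ η)
    (hent : ∀ P : (State × State) × (State × State) → ℝ,
      (∀ e, 0 ≤ P e) → ∑ e, P e = 1 →
      (∀ u, |∑ e with (twoState.prod twoState).src e = u, P e -
        ∑ e with (twoState.prod twoState).tgt e = u, P e| ≤ η) →
      |∑ e, P e * switch e.1 - p| ≤ η → |∑ e, P e * switch e.2 - p| ≤ η →
      ∑ e, P e * disagree e ≤ δ → condEntropy (twoState.prod twoState) P ≤ c) :
    ∃ C : Finset (Fin n → Fin 2), C.Nonempty ∧ vcDim C ≤ k ∧ MinDistAtLeast C (δ * n) ∧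
      2 * n * Real.binEntropy (k / n) - 20 * Real.log (n + 1) - 4 - Real.log 4
        - n * c * Real.log 2 ≤ Real.log C.card := by
  classical
  have hn' : (0 : ℝ) < n := by exact_mod_cast hn
  obtain ⟨C, hCS, hsep, hcard⟩ := exists_separated_subset
    (Finset.univ.filter fun x : Fin n → Fin 2 => (switches x).card = k)
    (fun x y => (hammingDist x y : ℝ) < δ * n)
    (fun x => by rw [hammingDist_self, Nat.cast_zero]; positivity)
    (fun x y h => by rwa [hammingDist_comm])
  set T := (((Finset.univ.filter fun x : Fin n → Fin 2 => (switches x).card = k) ×ˢ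
    (Finset.univ.filter fun x : Fin n → Fin 2 => (switches x).card = k)).filter
      fun z => (hammingDist z.1 z.2 : ℝ) < δ * n)
  have hT := card_close_pairs_le hn hη hk hent T fun z hz => by
    obtain ⟨hz1, hz2⟩ := Finset.mem_filter.1 hz
    obtain ⟨hz3, hz4⟩ := Finset.mem_product.1 hz1
    exact ⟨(Finset.mem_filter.1 hz3).2, (Finset.mem_filter.1 hz4).2, hz2⟩
  rw [card_filter_switches] at hcard
  have hM : 0 < n.choose k := Nat.choose_pos hkn
  have hCpos : 0 < C.card := by
    by_contra! h0
    have h1 : C.card = 0 := by omega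
    rw [h1, mul_zero] at hcard
    have := pow_pos hM 2
    omega
  refine ⟨C, Finset.card_pos.1 hCpos,
    vcDim_le C fun x hx => (Finset.mem_filter.1 (hCS hx)).2.le,
    fun x hx y hy hne => not_lt.1 (hsep x hx y hy hne), ?_⟩
  have hMr : (0 : ℝ) < n.choose k := by exact_mod_cast hM
  have hCr : (0 : ℝ) < C.card := by exact_mod_cast hCpos
  -- In logarithms, 16 log(n+1) from the types and 2 · 2 log(n+1) from the squared binomial make up
  -- the 20 log(n+1) of the claim.
  have h1 : ((n.choose k : ℕ) : ℝ) ^ 2 ≤ 4 * ((n + 1) ^ 16 * 2 ^ (n * c)) * C.card := by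
    have : ((n.choose k : ℕ) : ℝ) ^ 2 ≤ 4 * T.card * C.card := by exact_mod_cast hcard
    refine this.trans ?_
    gcongr
  have h2 := Real.log_le_log (by positivity) h1
  rw [Real.log_pow, Real.log_mul (by positivity) hCr.ne', Real.log_mul (by norm_num) (by positivity),
    Real.log_mul (by positivity) (by positivity), Real.log_pow, Real.log_rpow two_pos] at h2
  have h3 := mul_binEntropy_sub_le_log_choose hn hkn
  push_cast at h2
  linarith

theorem achievable_of_lt {d δ p R : ℝ} (hp : p ∈ Set.Icc 0 d) (hd : d ≤ 1) (hδ : 0 < δ)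
    (hR : R < 2 * (Real.binEntropy p / Real.log 2) - entropyG {p} δ) : Achievable d δ R := by
  have hL : 0 < Real.log 2 := Real.log_pos one_lt_two
  have hp1 : p ≤ 1 := hp.2.trans hd
  set h := Real.binEntropy p / Real.log 2 with hh
  -- The gap is spent in quarters: two on replacing p by ⌊pn⌋/n in the doubled entropy, one on the
  -- compactness bound, one on the logarithmic terms.
  set ε := (2 * h - entropyG {p} δ - R) / 4 with hεdef
  have hε : 0 < ε := by rw [hεdef]; linarith
  obtain ⟨η, hη, hent⟩ := exists_condEntropy_le_entropyG_add ⟨hp.1, hp1⟩ hδ hε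
  have hlim : Tendsto (fun n : ℕ => (⌊p * n⌋₊ : ℝ) / n) atTop (𝓝 p) :=
    (tendsto_nat_floor_mul_div_atTop hp.1).comp tendsto_natCast_atTop_atTop
  have hlimH : Tendsto (fun n : ℕ => Real.binEntropy ((⌊p * n⌋₊ : ℝ) / n)) atTop
      (𝓝 (Real.binEntropy p)) := (Real.binEntropy_continuous.tendsto p).comp hlim
  have hlog : Tendsto (fun n : ℕ => 20 * (Real.log (n + 1) / n) + (4 + Real.log 4) / n) atTop
      (𝓝 0) := by
    have h1 : Tendsto (fun n : ℕ => Real.log ((n : ℝ) + 1) / n) atTop (𝓝 0) := by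
      have := (Real.tendsto_pow_log_div_mul_add_atTop 1 (-1) 1 one_ne_zero).comp
        (tendsto_atTop_add_const_right _ (1 : ℝ) tendsto_natCast_atTop_atTop : Tendsto
          (fun n : ℕ => (n : ℝ) + 1) atTop atTop)
      refine this.congr fun n => ?_
      simp
    simpa using (h1.const_mul 20).add (tendsto_const_div_atTop_nhds_zero_nat (4 + Real.log 4))
  have hev : ∀ᶠ n : ℕ in atTop, ∃ C : Finset (Fin n → Fin 2), C.Nonempty ∧ R ≤ rate C ∧
      (vcDim C : ℝ) ≤ d * n ∧ MinDistAtLeast C (δ * n) := by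
    filter_upwards [eventually_gt_atTop 0,
      (tendsto_const_div_atTop_nhds_zero_nat (1 : ℝ)).eventually (eventually_le_nhds hη),
      hlim.eventually (Metric.closedBall_mem_nhds p hη),
      hlimH.eventually (eventually_ge_nhds (sub_lt_self (Real.binEntropy p) (mul_pos hε hL))),
      hlog.eventually (eventually_le_nhds (mul_pos hε hL))] with n hn h1 h2 h3 h4
    have hn' : (0 : ℝ) < n := by exact_mod_cast hn
    have hfloor : (⌊p * n⌋₊ : ℝ) ≤ p * n := Nat.floor_le (mul_nonneg hp.1 hn'.le)
    have hkn : ⌊p * n⌋₊ ≤ n := by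
      have : (⌊p * n⌋₊ : ℝ) ≤ n := hfloor.trans (mul_le_of_le_one_left hn'.le hp1)
      exact_mod_cast this
    obtain ⟨C, hC, hvc, hdist, hcard⟩ := exists_code hδ hn hkn h1
      h2 hent
    refine ⟨C, hC, ?_, ?_, hdist⟩
    · rw [rate, le_div_iff₀ hn', Real.logb, le_div_iff₀ hL]
      refine le_trans ?_ hcard
      have h5 : 20 * Real.log (n + 1) + (4 + Real.log 4) ≤ ε * Real.log 2 * n := by
        have := mul_le_mul_of_nonneg_right h4 hn'.le
        rwa [add_mul, mul_assoc, div_mul_cancel₀ _ hn'.ne', div_mul_cancel₀ _ hn'.ne'] at this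
      have h6 := mul_le_mul_of_nonneg_left h3 hn'.le
      have h7 : Real.binEntropy p = h * Real.log 2 := by rw [hh]; field_simp
      have h8 : R = 2 * h - entropyG {p} δ - 4 * ε := by rw [hεdef]; ring
      rw [h7] at h6
      rw [h8]
      linarith
    · have : (vcDim C : ℝ) ≤ (⌊p * n⌋₊ : ℝ) := by exact_mod_cast hvc
      exact this.trans (hfloor.trans (mul_le_mul_of_nonneg_right hp.2 hn'.le))
  exact Nat.frequently_atTop_iff_infinite.1 hev.frequently

end VCCode

theorem theorem3 (d δ : ℝ) (hd : d ∈ Set.Icc (0 : ℝ) (1 / 2)) (hδ : δ ∈ Set.Ioc (0 : ℝ) (1 / 2)) :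
    VCCode.capacity d δ ≥ VCCode.rateMA d δ := by
  refine csSup_le ((Set.nonempty_Icc.2 hd.1).image _) ?_
  rintro _ ⟨p, hp, rfl⟩
  have hd1 : d ≤ 1 := hd.2.trans (by norm_num)
  have hF := VCCode.entropyF_le (p := p) ⟨hp.1, hp.2.trans hd1⟩
  -- Only rates strictly below the target are shown achievable, which suffices for the supremum.
  refine le_of_forall_lt_imp_le_of_dense fun R hR => ?_
  refine le_csSup (VCCode.bddAbove_achievable d δ) (VCCode.achievable_of_lt hp hd1 hδ.1 ?_)
  have hR : R < 2 * VCCode.entropyF {p} - VCCode.entropyG {p} δ := hR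
  linarith
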